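/- A hemiring is an algebra $(R,+,\cdot,0)$ such that $(R,+,0)$ is a commutative monoid, $(R,\cdot)$ is a semigroup, multiplication distributes over addition on both sides, and $0r=0=r0$ for all $r\in R$. A left $R$-semimodule is a commutative monoid $(M,+,0)$ with a scalar multiplication $R\times M\to M$ satisfying $(rs)m=r(sm)$, $r(m+n)=rm+rn$, $(r+s)m=rm+sm$ and $r0=0=0m$. It is cancellative if $x+z=y+z$ implies $x=y$ in $M$, and faithful if $rM=0$ implies $r=0$. A nonzero cancellative left $R$-semimodule $M$ is irreducible if for all $m_1\neq m_2$ in $M$ and every $m\in M$ there are $r_1,r_2\in R$ with $m+r_1m_1+r_2m_2=r_1m_2+r_2m_1$. A hemiring is primitive if it has a faithful irreducible left semimodule. A right ideal $I$ of $R$ is right semiregular if for all $i_1,i_2\in I$ there are $j_1,j_2\in I$ with $i_1+j_1+i_1j_1+i_2j_2=i_2+j_2+i_1j_2+i_2j_1$. The Jacobson–Bourne radical $J(R)$ is the sum of all right semiregular right ideals of $R$, and $R$ is $J$-semisimple if $J(R)=0$. A subdirect product of a (possibly empty) family $(R_i)_{i\in I}$ of hemirings is a subhemiring $S$ of $\prod_{i\in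 I}R_i$ such that each coordinate projection maps $S$ onto $R_i$. A hemiring $R$ is semiisomorphic to a hemiring $S$ if there is a surjective hemiring homomorphism $f:R\to S$ such that $f(a)=0$ implies $a=0$. **Corollary 3.8.** A hemiring $R$ (not assumed additively cancellative) is $J$-semisimple if and only if $R$ is semiisomorphic to a subdirect product of primitive hemirings. -/

import Mathlib

universe u v w

namespace Hemiring

/-- Left semimodules over a hemiring. A hemiring is Mathlib's `NonUnitalSemiring`: a commutative
additive monoid with an associative, distributive multiplication for which `0` is absorbing. -/
class Semimodule (R : Type u) (M : Type v) [NonUnitalSemiring R] [AddCommMonoid M]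
    extends SMul R M where
  mul_smul : ∀ (r s : R) (m : M), (r * s) • m = r • (s • m)
  smul_add : ∀ (r : R) (m n : M), r • (m + n) = r • m + r • n
  add_smul : ∀ (r s : R) (m : M), (r + s) • m = r • m + s • m
  smul_zero : ∀ r : R, r • (0 : M) = 0
  zero_smul : ∀ m : M, (0 : R) • m = 0

/-- A nonzero cancellative left semimodule `M` is irreducible if for all `m₁ ≠ m₂` and all `m`
in `M` there are `r₁`, `r₂` with `m + r₁m₁ + r₂m₂ = r₁m₂ + r₂m₁`. -/
structure IsIrreducible (R : Type u) (M : Type v) [NonUnitalSemiring R] [AddCommMonoid M]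
    [Semimodule R M] : Prop where
  nonzero : ∃ m : M, m ≠ 0
  cancellative : ∀ x y z : M, x + z = y + z → x = y
  exists_eq : ∀ m₁ m₂ : M, m₁ ≠ m₂ → ∀ m : M, ∃ r₁ r₂ : R,
    m + r₁ • m₁ + r₂ • m₂ = r₁ • m₂ + r₂ • m₁

/-- A left semimodule is faithful if its annihilator `(0 : M) = {r | rM = 0}` is zero. -/
def IsFaithful (R : Type u) (M : Type v) [NonUnitalSemiring R] [AddCommMonoid M]
    [Semimodule R M] : Prop :=
  ∀ r : R, (∀ m : M, r • m = 0) → r = 0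

/-- A hemiring is primitive if it has a faithful irreducible left semimodule. -/
def IsPrimitive (R : Type u) [NonUnitalSemiring R] : Prop :=
  ∃ (M : Type u) (_ : AddCommMonoid M) (_ : Semimodule R M), IsIrreducible R M ∧ IsFaithful R M

/-- Right ideals, as additive submonoids closed under right multiplication. -/
def IsRightIdeal {R : Type u} [NonUnitalSemiring R] (I : AddSubmonoid R) : Prop :=
  ∀ a ∈ I, ∀ r : R, a * r ∈ I

/-- The right semiregularity condition of Bourne. -/
def IsRightSemiregular {R : Type u} [NonUnitalSemiring R] (I : AddSubmonoid R) : Prop :=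
  ∀ i₁ ∈ I, ∀ i₂ ∈ I, ∃ j₁ ∈ I, ∃ j₂ ∈ I,
    i₁ + j₁ + i₁ * j₁ + i₂ * j₂ = i₂ + j₂ + i₁ * j₂ + i₂ * j₁

/-- The Jacobson–Bourne radical `J(R)`: the sum of all right semiregular right ideals of `R`. -/
def jacobsonBourne (R : Type u) [NonUnitalSemiring R] : AddSubmonoid R :=
  sSup {I : AddSubmonoid R | IsRightIdeal I ∧ IsRightSemiregular I}

/-- A hemiring is `J`-semisimple if `J(R) = 0`. -/
def IsJSemisimple (R : Type u) [NonUnitalSemiring R] : Prop :=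
  jacobsonBourne R = ⊥

/-- A semiisomorphism is a surjective hemiring homomorphism with zero kernel `{a | f a = 0}`. -/
def IsSemiisomorphism {R : Type u} {S : Type v} [NonUnitalSemiring R] [NonUnitalSemiring S]
    (f : R →ₙ+* S) : Prop :=
  Function.Surjective f ∧ ∀ a : R, f a = 0 → a = 0

/-- A subhemiring of a direct product is a subdirect product of the factors if each coordinate
projection maps it onto the factor. -/
def IsSubdirectProduct {ι : Type w} {A : ι → Type v} [∀ i, NonUnitalSemiring (A i)]
    (S : NonUnitalSubsemiring (∀ i, A i)) : Prop :=
  ∀ i, Function.Surjective (fun s : S => (s : ∀ i, A i) i)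

end Hemiring

namespace Hemiring

open Algebra

/-! The radical is exactly the set of elements annihilating every irreducible left semimodule
(`jacobsonBourne_eq_irreducibleAnnihilator`), so J-semisimplicity means that irreducible semimodules
separate nonzero elements from zero. The images of the hemiring in their endomorphisms are the
primitive factors. Both inclusions pass to rings. A semiregular ideal acts quasi-regularly on the
difference group of an irreducible semimodule, hence kills it. Conversely, in an enveloping ring,
Jacobson's maximal left ideal argument inverts 1 + (a - b) for a, b in the annihilator. Pulling this
back gives semiregularity up to a common summand, which a change of witnesses absorbs. -/

/-! ### Difference groups and the action of semiregular ideals -/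

/-- The additive endomorphism `m ↦ r • m`. -/
def smulHom (R : Type u) (M : Type v) [NonUnitalSemiring R] [AddCommMonoid M]
    [Semimodule R M] : R →ₙ+* AddMonoid.End M where
  toFun r := { toFun := fun m => r • m
               map_zero' := Semimodule.smul_zero r
               map_add' := Semimodule.smul_add r }
  map_mul' r s := by ext m; exact Semimodule.mul_smul r s m
  map_zero' := by ext m; exact Semimodule.zero_smul m
  map_add' r s := by ext m; exact Semimodule.add_smul r s m

theorem smulHom_apply {R : Type u} {M : Type v} [NonUnitalSemiring R] [AddCommMonoid M]
    [Semimodule R M] (r : R) (m : M) : smulHom R M r m = r • m := rfl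

theorem lift_of {M : Type v} {G : Type w} [AddCommMonoid M] [AddCommGroup G] (g : M →+ G) (m : M) :
    GrothendieckAddGroup.lift g (GrothendieckAddGroup.of m) = g m :=
  DFunLike.congr_fun (GrothendieckAddGroup.lift.symm_apply_apply g) m

theorem grothendieckAddGroup_hom_ext {M : Type v} {G : Type w} [AddCommMonoid M] [AddCommGroup G]
    {g h : GrothendieckAddGroup M →+ G}
    (H : ∀ m, g (GrothendieckAddGroup.of m) = h (GrothendieckAddGroup.of m)) : g = h :=
  GrothendieckAddGroup.lift.symm.injective (AddMonoidHom.ext H)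

/-- The extension of additive endomorphisms to the group of differences. -/
noncomputable def grothendieckEnd (M : Type v) [AddCommMonoid M] :
    AddMonoid.End M →ₙ+* AddMonoid.End (GrothendieckAddGroup M) where
  toFun g := GrothendieckAddGroup.lift (GrothendieckAddGroup.of.comp g)
  map_mul' g h := grothendieckAddGroup_hom_ext fun m => (lift_of _ m).trans
    ((congrArg (GrothendieckAddGroup.lift (GrothendieckAddGroup.of.comp g))
      (lift_of (GrothendieckAddGroup.of.comp h) m)).trans (lift_of _ (h m))).symm
  map_zero' := grothendieckAddGroup_hom_ext fun m => (lift_of _ m).trans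
    (map_zero GrothendieckAddGroup.of)
  map_add' g h := grothendieckAddGroup_hom_ext fun m => (lift_of _ m).trans
    ((map_add GrothendieckAddGroup.of (g m) (h m)).trans
      (congrArg₂ (· + ·) (lift_of (GrothendieckAddGroup.of.comp g) m)
        (lift_of (GrothendieckAddGroup.of.comp h) m)).symm)

theorem grothendieckEnd_of {M : Type v} [AddCommMonoid M] (g : AddMonoid.End M) (m : M) :
    grothendieckEnd M g (GrothendieckAddGroup.of m) = GrothendieckAddGroup.of (g m) :=
  lift_of (GrothendieckAddGroup.of.comp g) m

/-- Differences of elements of a right semiregular `I` become left quasi-regular in every ring to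
which the hemiring maps. -/
theorem IsRightSemiregular.exists_left_inverse {R : Type u} [NonUnitalSemiring R]
    {I : AddSubmonoid R} (hI : IsRightSemiregular I) {E : Type v} [Ring E] (φ : R →ₙ+* E)
    {a b : R} (ha : a ∈ I) (hb : b ∈ I) : ∃ e : E, e * (1 + (φ a - φ b)) = 1 := by
  have key : ∀ x ∈ I, ∀ y ∈ I, ∃ p ∈ I, ∃ q ∈ I,
      (1 + (φ x - φ y)) * (1 + (φ p - φ q)) = 1 := by
    intro x hx y hy
    obtain ⟨p, hp, q, hq, h⟩ := hI x hx y hy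
    refine ⟨p, hp, q, hq, ?_⟩
    have h' := congrArg φ h
    simp only [map_add, map_mul] at h'
    rw [← sub_eq_zero] at h' ⊢
    rw [← h']
    noncomm_ring
  -- A right inverse of the same form has a right inverse itself, so it is two-sided.
  obtain ⟨p, hp, q, hq, h⟩ := key a ha b hb
  obtain ⟨s, -, t, -, h'⟩ := key p hp q hq
  exact ⟨_, by rwa [left_inv_eq_right_inv h h']⟩

/-- Right semiregular right ideals annihilate irreducible left semimodules. -/
theorem IsRightSemiregular.smul_eq_zero {R : Type u} [NonUnitalSemiring R] {I : AddSubmonoid R}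
    (hI : IsRightSemiregular I) (hr : IsRightIdeal I) {M : Type v} [AddCommMonoid M]
    [Semimodule R M] (hM : IsIrreducible R M) {a : R} (ha : a ∈ I) (m : M) : a • m = 0 := by
  by_contra hne
  obtain ⟨r₁, r₂, h⟩ := hM.exists_eq (a • m) 0 hne m
  simp only [Semimodule.smul_zero, add_zero, zero_add] at h
  set φ := (grothendieckEnd M).comp (smulHom R M) with hφ
  have hof (r : R) (x : M) :
      φ r (GrothendieckAddGroup.of x) = GrothendieckAddGroup.of (r • x) := by
    rw [hφ, NonUnitalRingHom.comp_apply, grothendieckEnd_of, smulHom_apply]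
  obtain ⟨e, he⟩ := hI.exists_left_inverse φ (hr a ha r₁) (hr a ha r₂)
  set n : GrothendieckAddGroup M := GrothendieckAddGroup.of (a • m) with hn
  -- Multiplying `h` by `a` moves the coefficients into the right ideal.
  have h0 : (1 + (φ (a * r₁) - φ (a * r₂))) n = 0 := by
    have h1 : GrothendieckAddGroup.of (a • (m + r₁ • a • m)) =
        GrothendieckAddGroup.of (a • r₂ • a • m) := by rw [h]
    rw [Semimodule.smul_add, map_add, ← Semimodule.mul_smul a r₁,
      ← Semimodule.mul_smul a r₂, ← hof (a * r₁), ← hof (a * r₂), ← hn] at h1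
    change n + (φ (a * r₁) n - φ (a * r₂) n) = 0
    rw [← add_sub_assoc, h1, sub_self]
  have h1 : n = 0 := by
    have := congrArg (fun g : AddMonoid.End (GrothendieckAddGroup M) => g n) he
    simp only [AddMonoid.End.coe_mul, Function.comp_apply, h0, map_zero] at this
    exact this.symm
  have : IsCancelAdd M :=
    { add_right_cancel := fun y x z h => hM.cancellative x z y h
      add_left_cancel := fun y x z h => hM.cancellative x z y (by
        rw [add_comm x, add_comm z]; exact h) }
  exact hne (GrothendieckAddGroup.of_injective (by rw [← hn, h1, map_zero]))

/-! ### Restriction of scalars and the common annihilator -/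

/-- Restriction of scalars along a homomorphism into a hemiring. -/
abbrev Semimodule.comp {R : Type u} {S : Type w} [NonUnitalSemiring R] [NonUnitalSemiring S]
    (f : R →ₙ+* S) (M : Type v) [AddCommMonoid M] [Semimodule S M] : Semimodule R M where
  smul r m := f r • m
  mul_smul r s m := by
    change f (r * s) • m = f r • f s • m
    rw [map_mul, Semimodule.mul_smul]
  smul_add r := Semimodule.smul_add (f r)
  add_smul r s m := by
    change f (r + s) • m = f r • m + f s • m
    rw [map_add, Semimodule.add_smul]
  smul_zero r := Semimodule.smul_zero (f r)
  zero_smul m := by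
    change f 0 • m = 0
    rw [map_zero, Semimodule.zero_smul]

theorem IsIrreducible.comp {R : Type u} {S : Type w} [NonUnitalSemiring R] [NonUnitalSemiring S]
    {f : R →ₙ+* S} (hf : Function.Surjective f) {M : Type v} [AddCommMonoid M] [Semimodule S M]
    (hM : IsIrreducible S M) : @IsIrreducible R M _ _ (Semimodule.comp f M) := by
  let _ := Semimodule.comp f M
  refine ⟨hM.nonzero, hM.cancellative, fun m₁ m₂ hne m => ?_⟩
  obtain ⟨s₁, s₂, h⟩ := hM.exists_eq m₁ m₂ hne m
  obtain ⟨r₁, rfl⟩ := hf s₁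
  obtain ⟨r₂, rfl⟩ := hf s₂
  exact ⟨r₁, r₂, h⟩

/-- The common annihilator of all irreducible left semimodules. -/
def irreducibleAnnihilator (R : Type u) [NonUnitalSemiring R] : AddSubmonoid R where
  carrier := {r | ∀ (M : Type u) (_ : AddCommMonoid M) (_ : Semimodule R M), IsIrreducible R M →
    ∀ m : M, r • m = 0}
  zero_mem' M _ _ _ m := Semimodule.zero_smul m
  add_mem' ha hb M _ _ hM m := by
    rw [Semimodule.add_smul, ha M _ _ hM, hb M _ _ hM, add_zero]

theorem mul_mem_irreducibleAnnihilator_left {R : Type u} [NonUnitalSemiring R] {a : R}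
    (ha : a ∈ irreducibleAnnihilator R) (r : R) : r * a ∈ irreducibleAnnihilator R :=
  fun M _ _ hM m => by rw [Semimodule.mul_smul, ha M _ _ hM, Semimodule.smul_zero]

theorem isRightIdeal_irreducibleAnnihilator (R : Type u) [NonUnitalSemiring R] :
    IsRightIdeal (irreducibleAnnihilator R) :=
  fun a ha r M _ _ hM m => by rw [Semimodule.mul_smul, ha M _ _ hM]

/-! ### Enveloping rings -/

/-- A homomorphism `φ` from a hemiring to a ring is an envelope if it is injective up to additive
cancellation and its image generates the ring together with `1`. -/
structure IsEnvelope {R : Type u} [NonUnitalSemiring R] {U : Type v} [Ring U] (φ : R →ₙ+* U) :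
    Prop where
  exists_rep : ∀ x : U, ∃ (n : ℤ) (a b : R), x = n + (φ a - φ b)
  exists_add_eq : ∀ a b : R, φ a = φ b → ∃ t, a + t = b + t

theorem exists_rep_zsmul {R : Type u} [NonUnitalSemiring R] {U : Type v} [Ring U] (φ : R →ₙ+* U)
    (z k : ℤ) (r : R) : ∃ (n : ℤ) (a b : R), z • ((k : U) + φ r) = n + (φ a - φ b) := by
  obtain ⟨n, rfl | rfl⟩ := z.eq_nat_or_neg
  · exact ⟨n * k, n • r, 0, by simp⟩
  · exact ⟨-(n * k), 0, n • r, by simp⟩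

-- Adjoin a unit over ℕ, then negatives by tensoring with ℤ.
open TensorProduct in
theorem exists_isEnvelope (R : Type u) [NonUnitalSemiring R] :
    ∃ (U : Type u) (_ : Ring U) (φ : R →ₙ+* U), IsEnvelope φ := by
  let ι : Unitization ℕ R →+* ℤ ⊗[ℕ] Unitization ℕ R :=
    Algebra.TensorProduct.includeRight.toRingHom
  let φ : R →ₙ+* ℤ ⊗[ℕ] Unitization ℕ R :=
    ι.toNonUnitalRingHom.comp
      (NonUnitalRingHomClass.toNonUnitalRingHom (Unitization.inrNonUnitalAlgHom ℕ R))
  refine ⟨ℤ ⊗[ℕ] Unitization ℕ R, inferInstance, φ, ⟨fun x => ?_, fun a b h => ?_⟩⟩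
  · induction x using TensorProduct.induction_on with
    | zero => exact ⟨0, 0, 0, by simp⟩
    | add x y hx hy =>
      obtain ⟨n, a, b, rfl⟩ := hx
      obtain ⟨n', a', b', rfl⟩ := hy
      exact ⟨n + n', a + a', b + b', by push_cast [map_add]; abel⟩
    | tmul z s =>
      have hs : (1 : ℤ) ⊗ₜ[ℕ] s = ((s.fst : ℤ) : ℤ ⊗[ℕ] Unitization ℕ R) + φ s.snd := by
        change ι s = _ + ι (Unitization.inr s.snd)
        conv_lhs => rw [← Unitization.inl_fst_add_inr_snd_eq s]
        rw [map_add]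
        congr 1
        have : (Unitization.inl s.fst : Unitization ℕ R) = (s.fst : Unitization ℕ R) := by
          exact map_natCast (Unitization.inlRingHom ℕ R) s.fst
        rw [this]
        simp
      have hz (n : ℤ) : n ⊗ₜ[ℕ] s = n • ((1 : ℤ) ⊗ₜ[ℕ] s) := by
        rw [TensorProduct.smul_tmul', smul_eq_mul, mul_one]
      rw [hz, hs]
      exact exists_rep_zsmul (U := ℤ ⊗[ℕ] Unitization ℕ R) φ z s.fst s.snd
  -- The second component maps the envelope back to the difference group, where equality is known to
  -- mean equality after adding some `t`.
  · let p : Unitization ℕ R →+ GrothendieckAddGroup R :=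
      GrothendieckAddGroup.of.comp (Unitization.sndHom ℕ ℕ R).toAddMonoidHom
    let g : ℤ ⊗[ℕ] Unitization ℕ R →+ GrothendieckAddGroup R :=
      TensorProduct.liftAddHom
        ((AddMonoidHom.compHom' p).comp (smulAddHom ℤ (GrothendieckAddGroup R))) (fun n z s => by
          change (n • z) • p s = z • p (n • s)
          rw [map_nsmul, smul_assoc, smul_comm])
    have hg (r : R) : g (φ r) = GrothendieckAddGroup.of r := by
      change (1 : ℤ) • p (Unitization.inr r) = _
      rw [one_smul]
      rfl
    have hab := congrArg g h
    rw [hg, hg] at hab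
    obtain ⟨t, ht⟩ := (AddLocalization.addMonoidOf (⊤ : AddSubmonoid R)).eq_iff_exists.1 hab
    exact ⟨t, by rw [add_comm a, add_comm b]; exact ht⟩

/-! ### Semiregularity of the annihilator -/

/-- An element annihilating all irreducible left semimodules is left quasi-regular. -/
theorem IsEnvelope.exists_left_inverse {R : Type u} [NonUnitalSemiring R] {U : Type u} [Ring U]
    {φ : R →ₙ+* U} (hφ : IsEnvelope φ) {a b : R} (ha : a ∈ irreducibleAnnihilator R)
    (hb : b ∈ irreducibleAnnihilator R) : ∃ e : U, e * (1 + (φ a - φ b)) = 1 := by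
  by_contra hne
  push Not at hne
  have htop : Ideal.span {1 + (φ a - φ b)} ≠ ⊤ := fun h => by
    obtain ⟨e, he⟩ := Ideal.mem_span_singleton'.1 ((Ideal.eq_top_iff_one _).1 h)
    exact hne e he
  obtain ⟨m, hm, hle⟩ := Ideal.exists_le_maximal _ htop
  have hmem : 1 + (φ a - φ b) ∈ m := hle (Ideal.mem_span_singleton_self _)
  have hsimple : IsSimpleModule U (U ⧸ m) := isSimpleModule_iff_isCoatom.2 hm.out
  have hnontriv : Nontrivial (U ⧸ m) := IsSimpleModule.nontrivial U (U ⧸ m)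
  let _ : Semimodule R (U ⧸ m) :=
    { smul := fun r x => φ r • x
      mul_smul := fun r s x => by
        change φ (r * s) • x = φ r • φ s • x
        rw [map_mul, SemigroupAction.mul_smul]
      smul_add := fun r x y => _root_.smul_add (φ r) x y
      add_smul := fun r s x => by
        change φ (r + s) • x = φ r • x + φ s • x
        rw [map_add, _root_.add_smul]
      smul_zero := fun r => _root_.smul_zero (φ r)
      zero_smul := fun x => by
        change φ 0 • x = 0
        rw [map_zero, _root_.zero_smul] }
  have hsmul (r : R) (x : U ⧸ m) : r • x = φ r • x := rfl
  -- If `a` and `b` kill the class of 1, then `φ a`, `φ b` and hence 1 lie in `m`.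
  suffices hkill : φ a • (Submodule.Quotient.mk 1 : U ⧸ m) = 0 ∧
      φ b • (Submodule.Quotient.mk 1 : U ⧸ m) = 0 by
    rw [← Submodule.Quotient.mk_smul, ← Submodule.Quotient.mk_smul,
      Submodule.Quotient.mk_eq_zero, Submodule.Quotient.mk_eq_zero, smul_eq_mul, smul_eq_mul,
      mul_one, mul_one] at hkill
    apply hm.ne_top
    rw [Ideal.eq_top_iff_one]
    have := m.sub_mem hmem (m.sub_mem hkill.1 hkill.2)
    rwa [add_sub_cancel_right] at this
  -- By simplicity, either the hemiring acts as zero, or no nonzero element is killed by all of it;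
  -- the latter yields irreducibility.
  let Z : Submodule U (U ⧸ m) :=
    { carrier := {x | ∀ r, φ r • x = 0}
      zero_mem' := fun r => _root_.smul_zero _
      add_mem' := fun hx hy r => by rw [_root_.smul_add, hx r, hy r, add_zero]
      smul_mem' := fun u x hx r => by
        obtain ⟨n, c, d, rfl⟩ := hφ.exists_rep u
        have h1 : φ r * (n + (φ c - φ d)) = n * φ r + (φ (r * c) - φ (r * d)) := by
          rw [map_mul, map_mul, mul_add, mul_sub, Int.cast_comm]
        rw [← SemigroupAction.mul_smul, h1, _root_.add_smul, _root_.sub_smul, SemigroupAction.mul_smul, hx, hx, hx,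
          _root_.smul_zero, sub_zero, add_zero] }
  have hZ (x : U ⧸ m) : x ∈ Z ↔ ∀ r, φ r • x = 0 := Iff.rfl
  rcases eq_bot_or_eq_top Z with hbot | htop'
  swap
  · have : ∀ x, x ∈ Z := fun x => htop' ▸ Submodule.mem_top
    exact ⟨this _ a, this _ b⟩
  have hirr : IsIrreducible R (U ⧸ m) := by
    refine ⟨exists_ne 0, fun x y z h => add_right_cancel h, fun x y hxy z => ?_⟩
    -- The irreducibility equation for `z` says `z = (φ r - φ s) • (y - x)`, so `W` must be
    -- everything.
    let W : Submodule U (U ⧸ m) :=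
      { carrier := {w | ∃ r s : R, w = (φ r - φ s) • (y - x)}
        zero_mem' := ⟨0, 0, by simp⟩
        add_mem' := by
          rintro _ _ ⟨r, s, rfl⟩ ⟨r', s', rfl⟩
          exact ⟨r + r', s + s', by rw [← _root_.add_smul, map_add, map_add, sub_add_sub_comm]⟩
        smul_mem' := by
          rintro u _ ⟨r, s, rfl⟩
          obtain ⟨n, c, d, rfl⟩ := hφ.exists_rep u
          obtain ⟨k, rfl | rfl⟩ := n.eq_nat_or_neg
          · refine ⟨k • r + (c * r + d * s), k • s + (c * s + d * r), ?_⟩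
            rw [← SemigroupAction.mul_smul]
            congr 1
            simp only [map_add, map_nsmul, map_mul, nsmul_eq_mul, Int.cast_natCast]
            noncomm_ring
          · refine ⟨k • s + (c * r + d * s), k • r + (c * s + d * r), ?_⟩
            rw [← SemigroupAction.mul_smul]
            congr 1
            simp only [map_add, map_nsmul, map_mul, nsmul_eq_mul, Int.cast_natCast, Int.cast_neg]
            noncomm_ring }
    have hW : W = ⊤ := by
      refine (eq_bot_or_eq_top W).resolve_left fun h0 => hxy ?_
      have : y - x ∈ Z := (hZ _).2 fun r => by
        have : φ r • (y - x) ∈ W := ⟨r, 0, by rw [map_zero, sub_zero]⟩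
        rwa [h0, Submodule.mem_bot] at this
      rw [hbot, Submodule.mem_bot, sub_eq_zero] at this
      exact this.symm
    obtain ⟨r, s, h⟩ : z ∈ W := hW ▸ Submodule.mem_top
    refine ⟨r, s, ?_⟩
    simp only [hsmul]
    rw [h, _root_.sub_smul, _root_.smul_sub, _root_.smul_sub]
    abel
  exact ⟨ha _ _ _ hirr _, hb _ _ _ hirr _⟩

/-- The right semiregularity equation holds in the annihilator up to a common summand. -/
theorem exists_rightSemiregular_add {R : Type u} [NonUnitalSemiring R] {a b : R}
    (ha : a ∈ irreducibleAnnihilator R) (hb : b ∈ irreducibleAnnihilator R) :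
    ∃ p ∈ irreducibleAnnihilator R, ∃ q ∈ irreducibleAnnihilator R, ∃ t : R,
      a + p + a * p + b * q + t = b + q + a * q + b * p + t := by
  obtain ⟨U, _, φ, hφ⟩ := exists_isEnvelope R
  have key : ∀ x ∈ irreducibleAnnihilator R, ∀ y ∈ irreducibleAnnihilator R,
      ∃ p ∈ irreducibleAnnihilator R, ∃ q ∈ irreducibleAnnihilator R,
        (1 + (φ p - φ q)) * (1 + (φ x - φ y)) = 1 := by
    intro x hx y hy
    obtain ⟨e, he⟩ := hφ.exists_left_inverse hx hy
    -- Expanding `e` on the right as an integer plus a difference puts `e - 1` among differences of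
    -- annihilator elements; the sign of the integer decides which of `x`, `y` gets the multiple
    -- `k`.
    have he' : e = 1 - e * (φ x - φ y) := by
      rw [mul_add, mul_one] at he
      exact eq_sub_of_add_eq he
    obtain ⟨n, c, d, hn⟩ := hφ.exists_rep e
    have hc (z : R) {w : R} (hw : w ∈ irreducibleAnnihilator R) :=
      mul_mem_irreducibleAnnihilator_left hw z
    have : ∃ p ∈ irreducibleAnnihilator R, ∃ q ∈ irreducibleAnnihilator R,
        e = 1 + (φ p - φ q) := by
      obtain ⟨k, rfl | rfl⟩ := n.eq_nat_or_neg
      · refine ⟨k • y + (c * y + d * x),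
          add_mem (nsmul_mem hy k) (add_mem (hc c hy) (hc d hx)), k • x + (c * x + d * y),
          add_mem (nsmul_mem hx k) (add_mem (hc c hx) (hc d hy)), ?_⟩
        rw [he', hn]
        simp only [map_add, map_nsmul, map_mul, nsmul_eq_mul, Int.cast_natCast]
        noncomm_ring
      · refine ⟨k • x + (c * y + d * x),
          add_mem (nsmul_mem hx k) (add_mem (hc c hy) (hc d hx)), k • y + (c * x + d * y),
          add_mem (nsmul_mem hy k) (add_mem (hc c hx) (hc d hy)), ?_⟩
        rw [he', hn]
        simp only [map_add, map_nsmul, map_mul, nsmul_eq_mul, Int.cast_natCast, Int.cast_neg]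
        noncomm_ring
    obtain ⟨p, hp, q, hq, rfl⟩ := this
    exact ⟨p, hp, q, hq, he⟩
  obtain ⟨p, hp, q, hq, h⟩ := key a ha b hb
  obtain ⟨s, -, t, -, h'⟩ := key p hp q hq
  refine ⟨p, hp, q, hq, hφ.exists_add_eq _ _ ?_⟩
  rw [left_inv_eq_right_inv h' h] at h'
  simp only [map_add, map_mul]
  rw [← sub_eq_zero] at h' ⊢
  rw [← h']
  noncomm_ring

/-- The sides `x`, `y` of the equation agree only after adding `t`, which need not lie in the
annihilator. Correcting `p` by `y` and `q` by `x` creates `a * y` and `b * x`; the further term `(a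
+ b) * t` does lie there and supplies the `a * t` and `b * t` that let `x` and `y` be exchanged. -/
theorem isRightSemiregular_irreducibleAnnihilator (R : Type u) [NonUnitalSemiring R] :
    IsRightSemiregular (irreducibleAnnihilator R) := by
  intro a ha b hb
  obtain ⟨p, hp, q, hq, t, h⟩ := exists_rightSemiregular_add ha hb
  have hr := isRightIdeal_irreducibleAnnihilator R
  set x := a + p + a * p + b * q with hx
  set y := b + q + a * q + b * p with hy
  have hxm : x ∈ irreducibleAnnihilator R :=
    add_mem (add_mem (add_mem ha hp) (hr a ha p)) (hr b hb q)
  have hym : y ∈ irreducibleAnnihilator R :=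
    add_mem (add_mem (add_mem hb hq) (hr a ha q)) (hr b hb p)
  have hcm : (a + b) * t ∈ irreducibleAnnihilator R := hr _ (add_mem ha hb) t
  refine ⟨p + y + (a + b) * t, add_mem (add_mem hp hym) hcm,
    q + x + (a + b) * t, add_mem (add_mem hq hxm) hcm, ?_⟩
  have h1 : a * y + a * t = a * x + a * t := by rw [← mul_add, ← mul_add, h]
  have h2 : b * x + b * t = b * y + b * t := by rw [← mul_add, ← mul_add, h]
  calc a + (p + y + (a + b) * t) + a * (p + y + (a + b) * t) + b * (q + x + (a + b) * t)
      = x + y + (a * y + a * t) + (b * x + b * t) +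
          (a * ((a + b) * t) + b * ((a + b) * t)) := by
        rw [hx]; simp only [mul_add, add_mul]; abel
    _ = x + y + (a * x + a * t) + (b * y + b * t) +
          (a * ((a + b) * t) + b * ((a + b) * t)) := by rw [h1, h2]
    _ = b + (q + x + (a + b) * t) + a * (q + x + (a + b) * t) + b * (p + y + (a + b) * t) := by
        rw [hy]
        simp only [mul_add, add_mul]; abel

/-- The Jacobson–Bourne radical is the common annihilator of the irreducible left semimodules. -/
theorem jacobsonBourne_eq_irreducibleAnnihilator (R : Type u) [NonUnitalSemiring R] :
    jacobsonBourne R = irreducibleAnnihilator R := by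
  apply le_antisymm
  · exact sSup_le fun I hI a ha M _ _ hM m => hI.2.smul_eq_zero hI.1 hM ha m
  · exact le_sSup ⟨isRightIdeal_irreducibleAnnihilator R,
      isRightSemiregular_irreducibleAnnihilator R⟩

/-! ### Primitive images and subdirect products -/

/-- The image of a hemiring in the endomorphisms of an irreducible semimodule is primitive. -/
theorem IsIrreducible.isPrimitive_srange {R M : Type u} [NonUnitalSemiring R] [AddCommMonoid M]
    [Semimodule R M] (hM : IsIrreducible R M) :
    IsPrimitive (NonUnitalRingHom.srange (smulHom R M)) := by
  let _ : Semimodule (NonUnitalRingHom.srange (smulHom R M)) M :=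
    { smul := fun g m => (g : AddMonoid.End M) m
      mul_smul := fun g h m => rfl
      smul_add := fun g m n => map_add (g : AddMonoid.End M) m n
      add_smul := fun g h m => rfl
      smul_zero := fun g => map_zero (g : AddMonoid.End M)
      zero_smul := fun m => rfl }
  refine ⟨M, inferInstance, inferInstance, ⟨hM.nonzero, hM.cancellative, fun m₁ m₂ hne m => ?_⟩,
    fun g hg => Subtype.ext (AddMonoidHom.ext hg)⟩
  obtain ⟨r₁, r₂, h⟩ := hM.exists_eq m₁ m₂ hne m
  exact ⟨⟨_, r₁, rfl⟩, ⟨_, r₂, rfl⟩, h⟩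

end Hemiring

theorem corollary3p8 (R : Type u) [NonUnitalSemiring R] :
    Hemiring.IsJSemisimple R ↔
      ∃ (ι : Type u) (A : ι → Type u) (_ : ∀ i, NonUnitalSemiring (A i))
        (S : NonUnitalSubsemiring (∀ i, A i)) (f : R →ₙ+* S),
        (∀ i, Hemiring.IsPrimitive (A i)) ∧ Hemiring.IsSubdirectProduct S ∧
          Hemiring.IsSemiisomorphism f := by
  rw [Hemiring.IsJSemisimple, Hemiring.jacobsonBourne_eq_irreducibleAnnihilator]
  constructor
  · intro h
    -- One separating semimodule per nonzero element keeps the index set in universe `u`.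
    have hex : ∀ r : {r : R // r ≠ 0}, ∃ (M : Type u) (_ : AddCommMonoid M)
        (_ : Hemiring.Semimodule R M), Hemiring.IsIrreducible R M ∧ ∃ m : M, r.1 • m ≠ 0 := by
      intro r
      by_contra hne
      push Not at hne
      have : r.1 ∈ Hemiring.irreducibleAnnihilator R := hne
      rw [h, AddSubmonoid.mem_bot] at this
      exact r.2 this
    choose M i₁ i₂ hM m hm using hex
    let F : R →ₙ+* ∀ r : {r : R // r ≠ 0},
        NonUnitalRingHom.srange (Hemiring.smulHom R (M r)) :=
      { toFun := fun a r => NonUnitalRingHom.srangeRestrict (Hemiring.smulHom R (M r)) a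
        map_mul' := fun a b => funext fun r => map_mul _ a b
        map_zero' := funext fun r => map_zero _
        map_add' := fun a b => funext fun r => map_add _ a b }
    refine ⟨{r : R // r ≠ 0}, fun r => NonUnitalRingHom.srange (Hemiring.smulHom R (M r)),
      inferInstance, NonUnitalRingHom.srange F,
      NonUnitalRingHom.srangeRestrict F,
      fun r => (hM r).isPrimitive_srange, fun r => ?_, NonUnitalRingHom.srangeRestrict_surjective F, fun a ha => ?_⟩
    · rintro ⟨_, a, rfl⟩
      exact ⟨⟨F a, a, rfl⟩, rfl⟩
    · by_contra hne
      apply hm ⟨a, hne⟩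
      have h0 : F a = 0 := congrArg Subtype.val ha
      have h1 := congrArg Subtype.val (congrFun h0 ⟨a, hne⟩)
      exact DFunLike.congr_fun h1 (m ⟨a, hne⟩)
  · rintro ⟨ι, A, _, S, f, hA, hS, hf, hker⟩
    rw [eq_bot_iff]
    intro a ha
    refine (AddSubmonoid.mem_bot).2 (hker a (Subtype.ext (funext fun i => ?_)))
    obtain ⟨M, _, _, hM, hfaith⟩ := hA i
    let g : R →ₙ+* A i := ((Pi.evalNonUnitalRingHom A i).comp (NonUnitalSubsemiringClass.subtype S)).comp f
    -- A faithful irreducible semimodule of a factor stays irreducible over `R`, as `g` is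
    -- surjective; so `a` kills it, and its coordinate vanishes.
    exact hfaith _ (ha M _ _ (hM.comp (f := g) ((hS i).comp hf)))
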